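/- Let $e \ge 1$ and $r \ge 2$ be integers. Write $\langle ab\rangle^{n} = abab\cdots$ for the alternating product with $n$ factors starting with $a$, and let $S_r=\{s_3,\dots,s_r\}$ (empty if $r=2$). Let $\mathbf{B}(e,e,r)$ be the braid group of type $(e,e,r)$, given by its Broué–Malle–Rouquier presentation: it is the group with generators $\{t_0,t_1\}\cup S_r$ and relations - $s_is_js_i=s_js_is_j$ for $|i-j|=1$, and $s_is_j=s_js_i$ for $|i-j|>1$ ($3\le i,j\le r$), - $\langle t_1t_0\rangle^e=\langle t_0t_1\rangle^e$, - $s_3t_is_3=t_is_3t_i$ for $i=0,1$ (if $r\ge 3$), - $s_jt_i=t_is_j$ for $i=0,1$ and $4\le j\le r$, - $(s_3t_1t_0)^2=(t_1t_0s_3)^2$ (if $r\ge 3$). In $\mathbf{B}(e,e,r)$ put $t_i=t_{i-1}t_{i-2}t_{i-1}^{-1}$ for $2\le i\le e-1$, index these elements by residues, and let $T_e=\{t_i\mid i\in\mathbb{Z}/e\}=\{t_0,\dots,t_{e-1}\}$ (for $e=1$ the relations give $t_1=t_0$). Let $\mathcal{P}^\oplus(e,e,r)$ be the presentation with generators $\{t_i\mid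 i\in\mathbb{Z}/e\}\cup S_r$ and relations - $s_is_js_i=s_js_is_j$ for $|i-j|=1$, and $s_is_j=s_js_i$ for $|i-j|>1$ ($3\le i,j\le r$), - $s_3t_is_3=t_is_3t_i$ for $i\in\mathbb{Z}/e$ (if $r\ge3$), - $s_jt_i=t_is_j$ for $i\in\mathbb{Z}/e$ and $4\le j\le r$, - $t_it_{i-1}=t_jt_{j-1}$ for $i,j\in\mathbb{Z}/e$, and let $\mathbf{B}^\oplus(e,e,r)$ be the monoid defined by $\mathcal{P}^\oplus(e,e,r)$ read as a monoid presentation. Then the submonoid of $\mathbf{B}(e,e,r)$ generated by $T_e\cup S_r$ is isomorphic to $\mathbf{B}^\oplus(e,e,r)$, by an isomorphism sending each generator $t_i$ and $s_j$ of $\mathbf{B}^\oplus(e,e,r)$ to the element of $\mathbf{B}(e,e,r)$ of the same name; that is, this submonoid is presented by $\mathcal{P}^\oplus(e,e,r)$ considered as a monoid presentation. -/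

import Mathlib

/-!
The braid group `B(e,e,r)` (through its Broué–Malle–Rouquier presentation) and the monoid
`B⊕(e,e,r)`, for positive integers `e` and `r ≥ 2`.
-/

namespace ParachuteBraid

/-- The alternating product `⟨ab⟩ⁿ = a b a b ⋯` with `n` factors, the first one being `a`. -/
def altProd {M : Type*} [Monoid M] (a b : M) : ℕ → M
  | 0 => 1
  | n + 1 => a * altProd b a n

/-- The circle of elements on `(g₁, g₀)`: `g_i = g_{i-1} g_{i-2} g_{i-1}⁻¹` for `i ≥ 2`. -/
def circle {G : Type*} [Group G] (g₁ g₀ : G) : ℕ → G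
  | 0 => g₀
  | 1 => g₁
  | n + 2 => circle g₁ g₀ (n + 1) * circle g₁ g₀ n * (circle g₁ g₀ (n + 1))⁻¹

/-- Index set of `S_r = {s_3, …, s_r}` (empty for `r = 2`). -/
abbrev SIdx (r : ℕ) : Type := {j : ℕ // 3 ≤ j ∧ j ≤ r}

/-! ### The braid group `B(e,e,r)` -/

/-- The generators `t_0, t_1, s_3, …, s_r` of the Broué–Malle–Rouquier presentation. -/
inductive BraidGen (r : ℕ) : Type
  | t₀ : BraidGen r
  | t₁ : BraidGen r
  | s (j : SIdx r) : BraidGen r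

/-- The letter `t_0` in the free group. -/
def ft₀ (r : ℕ) : FreeGroup (BraidGen r) := FreeGroup.of BraidGen.t₀

/-- The letter `t_1` in the free group. -/
def ft₁ (r : ℕ) : FreeGroup (BraidGen r) := FreeGroup.of BraidGen.t₁

/-- The letter `s_j` in the free group. -/
def fs {r : ℕ} (j : SIdx r) : FreeGroup (BraidGen r) := FreeGroup.of (BraidGen.s j)

/-- The defining relations `u = v` of the Broué–Malle–Rouquier presentation of `B(e,e,r)`. -/
inductive BraidRel (e r : ℕ) : FreeGroup (BraidGen r) → FreeGroup (BraidGen r) → Prop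
  | braid (i j : SIdx r) (h : |(i.1 : ℤ) - (j.1 : ℤ)| = 1) :
      BraidRel e r (fs i * fs j * fs i) (fs j * fs i * fs j)
  | comm (i j : SIdx r) (h : 1 < |(i.1 : ℤ) - (j.1 : ℤ)|) :
      BraidRel e r (fs i * fs j) (fs j * fs i)
  | alt : BraidRel e r (altProd (ft₁ r) (ft₀ r) e) (altProd (ft₀ r) (ft₁ r) e)
  | braid₀ (j : SIdx r) (h : j.1 = 3) :
      BraidRel e r (fs j * ft₀ r * fs j) (ft₀ r * fs j * ft₀ r)
  | braid₁ (j : SIdx r) (h : j.1 = 3) :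
      BraidRel e r (fs j * ft₁ r * fs j) (ft₁ r * fs j * ft₁ r)
  | comm₀ (j : SIdx r) (h : 4 ≤ j.1) : BraidRel e r (fs j * ft₀ r) (ft₀ r * fs j)
  | comm₁ (j : SIdx r) (h : 4 ≤ j.1) : BraidRel e r (fs j * ft₁ r) (ft₁ r * fs j)
  | triangle (j : SIdx r) (h : j.1 = 3) :
      BraidRel e r ((fs j * ft₁ r * ft₀ r) ^ 2) ((ft₁ r * ft₀ r * fs j) ^ 2)

/-- The braid group `B(e,e,r)`. -/
abbrev BraidGroup (e r : ℕ) : Type :=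
  PresentedGroup {w : FreeGroup (BraidGen r) | ∃ u v, BraidRel e r u v ∧ w = u * v⁻¹}

/-- The generator `s_j` of `B(e,e,r)`. -/
def BraidGroup.s (e : ℕ) {r : ℕ} (j : SIdx r) : BraidGroup e r :=
  PresentedGroup.of (BraidGen.s j)

/-- The element `t_i` of `B(e,e,r)` for `i ∈ ℤ/e`: the element of index `i ∈ {0, …, e-1}` of the
circle on the generators `(t_1, t_0)`. -/
def BraidGroup.t {e : ℕ} (r : ℕ) (i : ZMod e) : BraidGroup e r :=
  circle (PresentedGroup.of BraidGen.t₁) (PresentedGroup.of BraidGen.t₀) i.val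

/-- The submonoid of `B(e,e,r)` generated by `T_e ∪ S_r`. -/
def positiveSubmonoid (e r : ℕ) : Submonoid (BraidGroup e r) :=
  Submonoid.closure
    (Set.range (fun i : ZMod e => BraidGroup.t r i) ∪
      Set.range (fun j : SIdx r => BraidGroup.s e j))

/-! ### The monoid `B⊕(e,e,r)` -/

/-- The generators `T_e ∪ S_r` of the presentation `P⊕(e,e,r)`. -/
inductive PGen (e r : ℕ) : Type
  | t (i : ZMod e) : PGen e r
  | s (j : SIdx r) : PGen e r

/-- The letter `t_i` in the free monoid. -/
def mt {e : ℕ} (r : ℕ) (i : ZMod e) : FreeMonoid (PGen e r) := FreeMonoid.of (PGen.t i)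

/-- The letter `s_j` in the free monoid. -/
def ms (e : ℕ) {r : ℕ} (j : SIdx r) : FreeMonoid (PGen e r) := FreeMonoid.of (PGen.s j)

/-- The defining relations `u = v` of the presentation `P⊕(e,e,r)`. -/
inductive PRel (e r : ℕ) : FreeMonoid (PGen e r) → FreeMonoid (PGen e r) → Prop
  | r₁ (i j : SIdx r) (h : |(i.1 : ℤ) - (j.1 : ℤ)| = 1) :
      PRel e r (ms e i * ms e j * ms e i) (ms e j * ms e i * ms e j)
  | r₂ (i j : SIdx r) (h : 1 < |(i.1 : ℤ) - (j.1 : ℤ)|) :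
      PRel e r (ms e i * ms e j) (ms e j * ms e i)
  | r₃ (j : SIdx r) (h : j.1 = 3) (i : ZMod e) :
      PRel e r (ms e j * mt r i * ms e j) (mt r i * ms e j * mt r i)
  | r₄ (j : SIdx r) (h : 4 ≤ j.1) (i : ZMod e) :
      PRel e r (ms e j * mt r i) (mt r i * ms e j)
  | r₅ (i j : ZMod e) : PRel e r (mt r i * mt r (i - 1)) (mt r j * mt r (j - 1))

/-- The monoid `B⊕(e,e,r)` presented, as a monoid, by `P⊕(e,e,r)`. -/
abbrev PMonoid (e r : ℕ) : Type := PresentedMonoid (PRel e r)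

/-- The generator `t_i` of `B⊕(e,e,r)`. -/
def PMonoid.t {e : ℕ} (r : ℕ) (i : ZMod e) : PMonoid e r := PresentedMonoid.of _ (PGen.t i)

/-- The generator `s_j` of `B⊕(e,e,r)`. -/
def PMonoid.s (e : ℕ) {r : ℕ} (j : SIdx r) : PMonoid e r := PresentedMonoid.of _ (PGen.s j)

end ParachuteBraid

namespace ParachuteBraid

/-! ### Left cancellation in `B⊕(e,e,r)` -/

section Cancellation

variable {e r : ℕ}

/-! The heart of the matter is that $\mathbf{B}^\oplus(e,e,r)$ embeds into some group
(`PMonoid.exists_injective_units`). Every homomorphism from it to a group factors through the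
canonical map to $\mathbf{B}(e,e,r)$ (`PMonoid.exists_factor`), so this map is then injective, and
its image is visibly the submonoid in question.

The embedding is Ore's theorem, which needs two inputs. Left cancellation: any two distinct
generators $a,b$ are joined by exactly one relation $a\cdot(\cdots)=b\cdot(\cdots)$, up to symmetry.
Garside's induction on length shows that every equality $ax=by$ comes from a multiple of that
relation. Only transitivity is hard, and it is a check on triples of generators, `MeetsBelow.cube`.
A central common multiple: let $q_0=t_1t_0$, $q_{n+1}=s_{n+3}q_ns_{n+3}$ and $g=q_0\cdots q_{r-2}$.
Then $g$ commutes with each $s_j$ and satisfies $t_ig=gt_{i-r}$, so $g^e$ is central, and every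
generator divides it.

The two presentations are compared inside groups. There $t_it_{i-1}=t_1t_0$ determines all $t_i$
from $t_0,t_1$; the alternating relation says that $t_e=t_0$, and the triangle relation says that
$t_1t_0$ commutes with $s_3t_1t_0s_3$. -/

/-- The node of the Coxeter-like diagram carrying a generator: `2` for `t_i`, `j` for `s_j`. -/
def PGen.level : PGen e r → ℕ
  | .t _ => 2
  | .s j => j.1

/-- The shift `t_i ↦ t_{i-1}`, `s_j ↦ s_j` of the generators. -/
def PGen.shift : PGen e r → PGen e r
  | .t i => .t (i - 1)
  | .s j => .s j

/-- A generator of `B⊕(e,e,r)`. -/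
def gen (a : PGen e r) : PMonoid e r := PresentedMonoid.of _ a

@[simp] theorem PGen.level_shift (a : PGen e r) : a.shift.level = a.level := by
  cases a <;> rfl

theorem PGen.shift_injective : Function.Injective (PGen.shift : PGen e r → PGen e r) := by
  intro a b h
  cases a <;> cases b <;> simp_all [PGen.shift]

/-- A letter fixed by the shift is either some $s_j$, alone on its level, or $t_i$ with $1=0$ in
$\mathbb{Z}/e$, again alone on its level. -/
theorem PGen.ne_shift {a b : PGen e r} (h : a.level = b.level) (hab : a ≠ b) : a ≠ a.shift := by
  rcases a with i | ⟨i, hi⟩ <;> rcases b with j | ⟨j, hj⟩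
  · intro h'
    simp only [PGen.shift, PGen.t.injEq] at h'
    have h1 : (1 : ZMod e) = 0 := sub_eq_self.1 h'.symm
    have : Subsingleton (ZMod e) := subsingleton_of_zero_eq_one h1.symm
    exact hab (by rw [Subsingleton.elim i j])
  · simp only [PGen.level] at h; omega
  · simp only [PGen.level] at h; omega
  · simp only [PGen.level] at h; subst h; exact absurd rfl hab

/-- On level 2 this is `PRel.r₅`; higher levels carry a single letter. Levels thus sort pairs of
letters into three cases: equal, adjacent or distant. -/
theorem gen_mul_shift {a b : PGen e r} (h : a.level = b.level) :
    gen a * gen a.shift = gen b * gen b.shift := by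
  rcases a with i | ⟨i, hi⟩ <;> rcases b with j | ⟨j, hj⟩
  · exact PresentedMonoid.mk_eq_mk_of_rel (PRel.r₅ i j)
  · simp only [PGen.level] at h; omega
  · simp only [PGen.level] at h; omega
  · simp only [PGen.level] at h; subst h; rfl

theorem gen_braid {a b : PGen e r} (h : a.level + 1 = b.level ∨ b.level + 1 = a.level) :
    gen a * (gen b * gen a) = gen b * (gen a * gen b) := by
  simp only [← mul_assoc]
  rcases a with i | ⟨i, hi⟩ <;> rcases b with j | ⟨j, hj⟩ <;> simp only [PGen.level] at h
  · omega
  · exact (PresentedMonoid.mk_eq_mk_of_rel (PRel.r₃ ⟨j, hj⟩ (by simp only; omega) i)).symm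
  · exact PresentedMonoid.mk_eq_mk_of_rel (PRel.r₃ ⟨i, hi⟩ (by simp only; omega) j)
  · refine PresentedMonoid.mk_eq_mk_of_rel (PRel.r₁ ⟨i, hi⟩ ⟨j, hj⟩ ?_)
    rw [abs_eq (by norm_num)]; simp only; omega

theorem gen_comm {a b : PGen e r} (h : a.level + 1 < b.level ∨ b.level + 1 < a.level) :
    gen a * gen b = gen b * gen a := by
  rcases a with i | ⟨i, hi⟩ <;> rcases b with j | ⟨j, hj⟩ <;> simp only [PGen.level] at h
  · omega
  · exact (PresentedMonoid.mk_eq_mk_of_rel (PRel.r₄ ⟨j, hj⟩ (by simp only; omega) i)).symm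
  · exact PresentedMonoid.mk_eq_mk_of_rel (PRel.r₄ ⟨i, hi⟩ (by simp only; omega) j)
  · refine PresentedMonoid.mk_eq_mk_of_rel (PRel.r₂ ⟨i, hi⟩ ⟨j, hj⟩ ?_)
    rw [lt_abs]; simp only; omega

theorem gen_mul_shift_mul {a b : PGen e r} (h : a.level = b.level) (x : PMonoid e r) :
    gen a * (gen a.shift * x) = gen b * (gen b.shift * x) := by
  simp only [← mul_assoc, gen_mul_shift h]

theorem gen_braid_mul {a b : PGen e r} (h : a.level + 1 = b.level ∨ b.level + 1 = a.level)
    (x : PMonoid e r) :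
    gen a * (gen b * (gen a * x)) = gen b * (gen a * (gen b * x)) := by
  have := congrArg (· * x) (gen_braid h)
  simpa only [mul_assoc] using this

theorem gen_comm_mul {a b : PGen e r} (h : a.level + 1 < b.level ∨ b.level + 1 < a.level)
    (x : PMonoid e r) : gen a * (gen b * x) = gen b * (gen a * x) := by
  simp only [← mul_assoc, gen_comm h]

/-- The length homomorphism of the homogeneous monoid `B⊕(e,e,r)`. -/
def lengthHom (e r : ℕ) : PMonoid e r →* Multiplicative ℕ :=
  PresentedMonoid.lift (fun _ => Multiplicative.ofAdd 1) (by
    intro a b h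
    cases h <;> simp [ms, mt])

/-- The length of an element of `B⊕(e,e,r)`. -/
def len (x : PMonoid e r) : ℕ := (lengthHom e r x).toAdd

@[simp] theorem len_mul (x y : PMonoid e r) : len (x * y) = len x + len y := by
  simp [len]

@[simp] theorem len_gen (a : PGen e r) : len (gen a) = 1 := rfl

theorem len_mk (w : FreeMonoid (PGen e r)) : len (PresentedMonoid.mk _ w) = w.length := by
  induction w with
  | one => simp [len]
  | of a => rfl
  | mul x y hx hy => simp [hx, hy]

open Classical in
/-- The right complement of `a` by `b`: `a * compl a b = b * compl b a`. -/
noncomputable def compl (a b : PGen e r) : PMonoid e r :=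
  if a = b then 1
  else if a.level = b.level then gen a.shift
  else if a.level + 1 = b.level ∨ b.level + 1 = a.level then gen b * gen a
  else gen b

theorem compl_self (a : PGen e r) : compl a a = 1 := by simp [compl]

theorem compl_level {a b : PGen e r} (hab : a ≠ b) (h : a.level = b.level) :
    compl a b = gen a.shift := by simp [compl, hab, h]

theorem compl_braid {a b : PGen e r} (h : a.level + 1 = b.level ∨ b.level + 1 = a.level) :
    compl a b = gen b * gen a := by
  have h1 : a.level ≠ b.level := by omega
  have h2 : a ≠ b := fun h => h1 (by rw [h])
  simp [compl, h, h1, h2]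

theorem compl_comm {a b : PGen e r} (h : a.level + 1 < b.level ∨ b.level + 1 < a.level) :
    compl a b = gen b := by
  have h1 : a.level ≠ b.level := by omega
  have h2 : a ≠ b := fun h => h1 (by rw [h])
  have h3 : ¬ (a.level + 1 = b.level ∨ b.level + 1 = a.level) := by omega
  simp [compl, h1, h2, h3]

/-- `a * x` and `b * y` are equal through a common multiple of `a * compl a b`. -/
def Meets (a b : PGen e r) (x y : PMonoid e r) : Prop :=
  ∃ z, x = compl a b * z ∧ y = compl b a * z

theorem Meets.symm {a b : PGen e r} {x y : PMonoid e r} (h : Meets a b x y) : Meets b a y x := by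
  obtain ⟨z, h1, h2⟩ := h
  exact ⟨z, h2, h1⟩

theorem meets_self {a : PGen e r} {x y : PMonoid e r} : Meets a a x y ↔ x = y := by
  simp only [Meets, compl_self, one_mul]
  exact ⟨fun ⟨z, h, h'⟩ => h.trans h'.symm, fun h => ⟨x, rfl, h.symm⟩⟩

/-- Equalities between elements of length at most `n` factor through complements. -/
def MeetsBelow (e r n : ℕ) : Prop :=
  ∀ (a b : PGen e r) (x y : PMonoid e r), len x < n → gen a * x = gen b * y → Meets a b x y

namespace MeetsBelow

variable {n : ℕ} {a b : PGen e r} {x y : PMonoid e r}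

theorem cancel (H : MeetsBelow e r n) (hx : len x < n) (h : gen a * x = gen a * y) : x = y :=
  meets_self.1 (H a a x y hx h)

theorem level (H : MeetsBelow e r n) (hx : len x < n) (hab : a ≠ b) (hl : a.level = b.level)
    (h : gen a * x = gen b * y) : ∃ z, x = gen a.shift * z ∧ y = gen b.shift * z := by
  obtain ⟨z, h1, h2⟩ := H a b x y hx h
  exact ⟨z, by rw [h1, compl_level hab hl], by rw [h2, compl_level hab.symm hl.symm]⟩

theorem braid (H : MeetsBelow e r n) (hx : len x < n) (hl : a.level + 1 = b.level ∨ b.level + 1 = a.level)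
    (h : gen a * x = gen b * y) :
    ∃ z, x = gen b * (gen a * z) ∧ y = gen a * (gen b * z) := by
  obtain ⟨z, h1, h2⟩ := H a b x y hx h
  exact ⟨z, by rw [h1, compl_braid hl, mul_assoc], by rw [h2, compl_braid hl.symm, mul_assoc]⟩

theorem comm (H : MeetsBelow e r n) (hx : len x < n) (hl : a.level + 1 < b.level ∨ b.level + 1 < a.level)
    (h : gen a * x = gen b * y) : ∃ z, x = gen b * z ∧ y = gen a * z := by
  obtain ⟨z, h1, h2⟩ := H a b x y hx h
  exact ⟨z, by rw [h1, compl_comm hl], by rw [h2, compl_comm hl.symm]⟩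

end MeetsBelow

end Cancellation
end ParachuteBraid
namespace ParachuteBraid

/-! ### The cube condition on triples of generators. -/

section Cube

variable {e r n : ℕ} {a b c : PGen e r} {u v : PMonoid e r}

namespace MeetsBelow

/-- This and the next lemmas are the cases of `cube`, sorted by the relative levels of $a,b,c$. The
hypothesis `h` equates the two expressions of the middle word. Since it is short, `H` can be applied
until both sides are written through one parameter, and the defining relations then exhibit the
common factor. -/
theorem cube_far_level (H : MeetsBelow e r n) (hab : a ≠ b) (hl : a.level = b.level)
    (hc : c.level + 1 < a.level ∨ a.level + 1 < c.level) (hn : len (gen a * u) ≤ n)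
    (h : gen a * u = gen b * v) : Meets a b (gen c * u) (gen c * v) := by
  simp only [len_mul, len_gen] at hn
  obtain ⟨z, rfl, rfl⟩ := H.level (by omega) hab hl h
  refine ⟨gen c * z, ?_, ?_⟩
  · rw [compl_level hab hl, gen_comm_mul (by simpa using hc)]
  · rw [compl_level hab.symm hl.symm, gen_comm_mul (by simpa [← hl] using hc)]

theorem cube_adj_level (H : MeetsBelow e r n) (hab : a ≠ b) (hl : a.level = b.level)
    (hc : c.level + 1 = a.level ∨ a.level + 1 = c.level)
    (hn : len (gen a * (gen c * u)) ≤ n)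
    (h : gen a * (gen c * u) = gen b * (gen c * v)) :
    Meets a b (gen c * (gen a * u)) (gen c * (gen b * v)) := by
  have hL := congrArg len h
  simp only [len_mul, len_gen] at hn hL
  obtain ⟨z, h1, h2⟩ := H.level (by simp; omega) hab hl h
  have hL1 := congrArg len h1
  have hL2 := congrArg len h2
  simp only [len_mul, len_gen] at hL1 hL2
  obtain ⟨p, rfl, rfl⟩ := H.braid (by omega) (by simpa using hc) h1
  obtain ⟨q, rfl, h3⟩ := H.braid (by omega) (by simpa [← hl] using hc) h2
  simp only [len_mul, len_gen] at hn hL hL1 hL2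
  obtain ⟨w, rfl, rfl⟩ := H.level (by omega) (fun h => hab (PGen.shift_injective h))
    (by simpa using hl) (H.cancel (by simp; omega) h3)
  refine ⟨gen c * (gen a.shift * (gen a.shift.shift * (gen c * w))), ?_, ?_⟩
  · rw [compl_level hab hl, gen_mul_shift_mul (a := a) (b := a.shift) (by simp),
      ← gen_braid_mul (a := c) (b := a.shift.shift) (by simpa using hc),
      gen_braid_mul (a := c) (b := a.shift) (by simpa using hc)]
  · rw [compl_level hab.symm hl.symm, gen_mul_shift_mul (a := b) (b := b.shift) (by simp),
      ← gen_braid_mul (a := c) (b := b.shift.shift) (by simpa [← hl] using hc),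
      gen_braid_mul (a := c) (b := b.shift) (by simpa [← hl] using hc),
      gen_mul_shift_mul (a := a.shift) (b := b.shift) (by simpa using hl)]

theorem cube_level_far (H : MeetsBelow e r n) (hl : c.level = a.level)
    (hc : c.level + 1 < b.level ∨ b.level + 1 < c.level)
    (hn : len (gen c.shift * u) ≤ n) (h : gen c.shift * u = gen b * v) :
    Meets a b (gen a.shift * u) (gen c * v) := by
  simp only [len_mul, len_gen] at hn
  obtain ⟨z, rfl, rfl⟩ := H.comm (by omega) (by simpa using hc) h
  refine ⟨gen a.shift * z, ?_, ?_⟩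
  · rw [compl_comm (by simpa [← hl] using hc), gen_comm_mul (by simpa [← hl] using hc)]
  · rw [compl_comm (by simpa [← hl] using hc.symm), gen_mul_shift_mul hl]

theorem cube_level_adj (H : MeetsBelow e r n) (hca : c ≠ a) (hl : c.level = a.level)
    (hc : c.level + 1 = b.level ∨ b.level + 1 = c.level)
    (hn : len (gen c.shift * u) ≤ n) (h : gen c.shift * u = gen b * (gen c * v)) :
    Meets a b (gen a.shift * u) (gen c * (gen b * v)) := by
  have hL := congrArg len h
  simp only [len_mul, len_gen] at hn hL
  obtain ⟨p, rfl, h1⟩ := H.braid (by omega) (by simpa using hc) h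
  have hL1 := congrArg len h1
  simp only [len_mul, len_gen] at hn hL hL1
  -- The letter $a\ne c$ on the level of $c$ excludes $e=1$, so $c$ differs from its shift and the
  -- equal-level case applies to these two.
  obtain ⟨z, rfl, h2⟩ := H.level (by omega) (PGen.ne_shift hl hca) (by simp) h1
  simp only [len_mul, len_gen] at hn hL hL1
  obtain ⟨q, rfl, rfl⟩ := H.braid (by omega) (by simpa using hc.symm) h2
  have ha : a.level + 1 = b.level ∨ b.level + 1 = a.level := by simpa [← hl] using hc
  have hs : gen c.shift * (gen c.shift.shift * (gen b * q)) =
      gen a.shift * (gen a.shift.shift * (gen b * q)) :=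
    gen_mul_shift_mul (by simpa using hl) _
  refine ⟨gen a.shift * (gen b * (gen a.shift.shift * q)), ?_, ?_⟩
  · rw [compl_braid ha, mul_assoc, hs,
      gen_braid_mul (a := a.shift) (b := b) (by simpa using ha),
      ← gen_braid_mul (a := a.shift.shift) (b := b) (by simpa using ha),
      gen_mul_shift_mul (a := a) (b := a.shift) (by simp)]
  · rw [compl_braid ha.symm, mul_assoc,
      ← gen_braid_mul (a := c.shift) (b := b) (by simpa using hc),
      gen_mul_shift_mul hl, gen_mul_shift_mul (a := c.shift) (b := a.shift) (by simpa using hl),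
      gen_braid_mul (a := a.shift) (b := b) (by simpa using ha)]

theorem cube_comm_comm_comm (H : MeetsBelow e r n)
    (hca : c.level + 1 < a.level ∨ a.level + 1 < c.level)
    (hcb : c.level + 1 < b.level ∨ b.level + 1 < c.level)
    (hab : a.level + 1 < b.level ∨ b.level + 1 < a.level)
    (hn : len (gen a * u) ≤ n) (h : gen a * u = gen b * v) :
    Meets a b (gen c * u) (gen c * v) := by
  simp only [len_mul, len_gen] at hn
  obtain ⟨z, rfl, rfl⟩ := H.comm (by omega) hab h
  refine ⟨gen c * z, ?_, ?_⟩
  · rw [compl_comm hab, gen_comm_mul hcb]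
  · rw [compl_comm hab.symm, gen_comm_mul hca]

theorem cube_comm_comm_braid (H : MeetsBelow e r n)
    (hca : c.level + 1 < a.level ∨ a.level + 1 < c.level)
    (hcb : c.level + 1 < b.level ∨ b.level + 1 < c.level)
    (hab : a.level + 1 = b.level ∨ b.level + 1 = a.level)
    (hn : len (gen a * u) ≤ n) (h : gen a * u = gen b * v) :
    Meets a b (gen c * u) (gen c * v) := by
  simp only [len_mul, len_gen] at hn
  obtain ⟨z, rfl, rfl⟩ := H.braid (by omega) hab h
  refine ⟨gen c * z, ?_, ?_⟩
  · rw [compl_braid hab, mul_assoc, gen_comm_mul hcb, gen_comm_mul hca]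
  · rw [compl_braid hab.symm, mul_assoc, gen_comm_mul hca, gen_comm_mul hcb]

theorem cube_comm_braid_comm (H : MeetsBelow e r n)
    (hca : c.level + 1 < a.level ∨ a.level + 1 < c.level)
    (hcb : c.level + 1 = b.level ∨ b.level + 1 = c.level)
    (hab : a.level + 1 < b.level ∨ b.level + 1 < a.level)
    (hn : len (gen a * u) ≤ n) (h : gen a * u = gen b * (gen c * v)) :
    Meets a b (gen c * u) (gen c * (gen b * v)) := by
  have hL := congrArg len h
  simp only [len_mul, len_gen] at hn hL
  obtain ⟨z, rfl, h1⟩ := H.comm (by omega) hab h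
  simp only [len_mul, len_gen] at hn hL
  obtain ⟨q, rfl, rfl⟩ := H.comm (by omega) hca h1
  refine ⟨gen c * (gen b * q), ?_, ?_⟩
  · rw [compl_comm hab, gen_braid_mul hcb]
  · rw [compl_comm hab.symm, gen_comm_mul hab.symm, gen_comm_mul hca]

theorem cube_comm_braid_braid (H : MeetsBelow e r n)
    (hca : c.level + 1 < a.level ∨ a.level + 1 < c.level)
    (hcb : c.level + 1 = b.level ∨ b.level + 1 = c.level)
    (hab : a.level + 1 = b.level ∨ b.level + 1 = a.level)
    (hn : len (gen a * u) ≤ n) (h : gen a * u = gen b * (gen c * v)) :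
    Meets a b (gen c * u) (gen c * (gen b * v)) := by
  have hL := congrArg len h
  simp only [len_mul, len_gen] at hn hL
  obtain ⟨z, rfl, h1⟩ := H.braid (by omega) hab h
  have hL1 := congrArg len h1
  simp only [len_mul, len_gen] at hn hL hL1
  obtain ⟨p, rfl, h2⟩ := H.comm (by omega) hca h1
  simp only [len_mul, len_gen] at hn hL hL1
  obtain ⟨q, rfl, rfl⟩ := H.braid (by omega) hcb.symm h2
  refine ⟨gen c * (gen b * (gen a * q)), ?_, ?_⟩
  · rw [compl_braid hab, mul_assoc, ← gen_comm_mul hca (gen b * q), gen_braid_mul hcb,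
      ← gen_braid_mul hab, gen_comm_mul hca]
  · rw [compl_braid hab.symm, mul_assoc, ← gen_braid_mul hab, gen_comm_mul hca,
      ← gen_comm_mul hca q, gen_braid_mul hcb]

theorem cube_braid_braid_comm (H : MeetsBelow e r n)
    (hca : c.level + 1 = a.level ∨ a.level + 1 = c.level)
    (hcb : c.level + 1 = b.level ∨ b.level + 1 = c.level)
    (hab : a.level + 1 < b.level ∨ b.level + 1 < a.level)
    (hn : len (gen a * (gen c * u)) ≤ n)
    (h : gen a * (gen c * u) = gen b * (gen c * v)) :
    Meets a b (gen c * (gen a * u)) (gen c * (gen b * v)) := by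
  have hL := congrArg len h
  simp only [len_mul, len_gen] at hn hL
  obtain ⟨z, h1, h2⟩ := H.comm (by simp; omega) hab h
  have hL1 := congrArg len h1
  have hL2 := congrArg len h2
  simp only [len_mul, len_gen] at hL1 hL2
  obtain ⟨p, rfl, rfl⟩ := H.braid (by omega) hcb h1
  obtain ⟨q, rfl, h3⟩ := H.braid (by omega) hca h2
  simp only [len_mul, len_gen] at hn hL hL1 hL2
  obtain ⟨w, rfl, rfl⟩ := H.comm (by omega) hab.symm (H.cancel (by simp; omega) h3)
  refine ⟨gen c * (gen b * (gen a * (gen c * w))), ?_, ?_⟩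
  · rw [compl_comm hab, gen_comm_mul hab, ← gen_braid_mul hca, gen_braid_mul hcb]
  · rw [compl_comm hab.symm, gen_comm_mul hab.symm, ← gen_braid_mul hcb, gen_braid_mul hca,
      gen_comm_mul hab]

/-- The cube condition: meeting at `c` is transitive. -/
theorem cube (H : MeetsBelow e r n) {x y w : PMonoid e r} (hw : len w ≤ n)
    (h1 : Meets a c x w) (h2 : Meets c b w y) : Meets a b x y := by
  by_cases hac : a = c
  · subst hac; rwa [meets_self.1 h1]
  by_cases hcb : c = b
  · subst hcb; rwa [← meets_self.1 h2]
  obtain ⟨u, rfl, rfl⟩ := h1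
  obtain ⟨v, h, rfl⟩ := h2
  have hca := Ne.symm hac
  have hbc := Ne.symm hcb
  have tri : ∀ m n : ℕ, m = n ∨ (m + 1 = n ∨ n + 1 = m) ∨ (m + 1 < n ∨ n + 1 < m) := by
    intro m n; omega
  by_cases hab : a = b
  · subst hab
    rw [meets_self]
    rcases tri c.level a.level with k | k | k
    · rw [compl_level hca k] at h hw
      simp only [len_mul, len_gen] at hw
      rw [H.cancel (by omega) h]
    · rw [compl_braid k, mul_assoc, mul_assoc] at h
      rw [compl_braid k] at hw
      simp only [len_mul, len_gen] at hw
      have h' := H.cancel (by simp; omega) h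
      rw [H.cancel (by omega) h']
    · rw [compl_comm k] at h hw
      simp only [len_mul, len_gen] at hw
      rw [H.cancel (by omega) h]
  -- The condition is symmetric in $a$ and $b$; this bound serves the cases obtained by exchanging
  -- them.
  have hw' : len (compl c b * v) ≤ n := h ▸ hw
  rcases tri c.level a.level with k | k | k <;> rcases tri c.level b.level with l | l | l
  · rw [compl_level hca k] at h hw
    rw [compl_level hcb l] at h
    simp only [len_mul, len_gen] at hw
    rw [compl_level hac k.symm, compl_level hbc l.symm, H.cancel (by omega) h]
    exact ⟨v, by rw [compl_level hab (k.symm.trans l)],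
      by rw [compl_level (Ne.symm hab) (l.symm.trans k)]⟩
  · rw [compl_level hca k] at h hw
    rw [compl_braid l, mul_assoc] at h
    rw [compl_level hac k.symm, compl_braid l.symm, mul_assoc]
    exact H.cube_level_adj hca k l hw h
  · rw [compl_level hca k] at h hw
    rw [compl_comm l] at h
    rw [compl_level hac k.symm, compl_comm l.symm]
    exact H.cube_level_far k l hw h
  · rw [compl_braid k, mul_assoc] at h
    rw [compl_level hcb l] at h hw'
    rw [compl_braid k.symm, compl_level hbc l.symm, mul_assoc]
    exact (H.cube_level_adj hcb l k hw' h.symm).symm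
  · rw [compl_braid k, mul_assoc] at h hw
    rw [compl_braid l, mul_assoc] at h
    rw [compl_braid k.symm, compl_braid l.symm, mul_assoc, mul_assoc]
    rcases tri a.level b.level with m | m | m
    · exact H.cube_adj_level hab m k hw h
    -- Levels lie on a path, so three letters are never pairwise adjacent.
    · omega
    · exact H.cube_braid_braid_comm k l m hw h
  · rw [compl_braid k, mul_assoc] at h
    rw [compl_comm l] at h hw'
    rw [compl_braid k.symm, compl_comm l.symm, mul_assoc]
    rcases tri b.level a.level with m | m | m
    · omega
    · exact (H.cube_comm_braid_braid l k m hw' h.symm).symm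
    · exact (H.cube_comm_braid_comm l k m hw' h.symm).symm
  · rw [compl_comm k] at h
    rw [compl_level hcb l] at h hw'
    rw [compl_comm k.symm, compl_level hbc l.symm]
    exact (H.cube_level_far l k hw' h.symm).symm
  · rw [compl_comm k] at h hw
    rw [compl_braid l, mul_assoc] at h
    rw [compl_comm k.symm, compl_braid l.symm, mul_assoc]
    rcases tri a.level b.level with m | m | m
    · omega
    · exact H.cube_comm_braid_braid k l m hw h
    · exact H.cube_comm_braid_comm k l m hw h
  · rw [compl_comm k] at h hw
    rw [compl_comm l] at h
    rw [compl_comm k.symm, compl_comm l.symm]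
    rcases tri a.level b.level with m | m | m
    · exact H.cube_far_level hab m k hw h
    · exact H.cube_comm_comm_braid k l m hw h
    · exact H.cube_comm_comm_comm k l m hw h

end MeetsBelow

/-! ### From the cube condition to left cancellation. -/

/-- Two words that are both nonempty meet at their first letters. -/
def HeadsMeet (w w' : FreeMonoid (PGen e r)) : Prop :=
  ∀ a x b y, w = FreeMonoid.of a * x → w' = FreeMonoid.of b * y →
    Meets a b (PresentedMonoid.mk _ x) (PresentedMonoid.mk _ y)

theorem headsMeet_of {x y : FreeMonoid (PGen e r)}
    (h : Meets a b (PresentedMonoid.mk _ x) (PresentedMonoid.mk _ y)) :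
    HeadsMeet (FreeMonoid.of a * x) (FreeMonoid.of b * y) := by
  intro a' x' b' y' h1 h2
  obtain ⟨rfl, rfl⟩ := List.cons.inj h1
  obtain ⟨rfl, rfl⟩ := List.cons.inj h2
  exact h

theorem headsMeet_of_rel {w w' : FreeMonoid (PGen e r)} (h : PRel e r w w') :
    HeadsMeet w w' := by
  cases h with
  | r₁ i j h =>
    rw [abs_eq (by norm_num)] at h
    have k : (PGen.s i : PGen e r).level + 1 = (PGen.s j : PGen e r).level ∨
        (PGen.s j : PGen e r).level + 1 = (PGen.s i : PGen e r).level := by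
      simp only [PGen.level]; omega
    rw [mul_assoc, mul_assoc]
    refine headsMeet_of ⟨1, ?_, ?_⟩
    · rw [compl_braid k, mul_one]; rfl
    · rw [compl_braid k.symm, mul_one]; rfl
  | r₂ i j h =>
    rw [lt_abs] at h
    have k : (PGen.s i : PGen e r).level + 1 < (PGen.s j : PGen e r).level ∨
        (PGen.s j : PGen e r).level + 1 < (PGen.s i : PGen e r).level := by
      simp only [PGen.level]; omega
    refine headsMeet_of ⟨1, ?_, ?_⟩
    · rw [compl_comm k, mul_one]; rfl
    · rw [compl_comm k.symm, mul_one]; rfl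
  | r₃ j h i =>
    have k : (PGen.s j : PGen e r).level + 1 = (PGen.t i : PGen e r).level ∨
        (PGen.t i : PGen e r).level + 1 = (PGen.s j : PGen e r).level := by
      simp only [PGen.level]; omega
    rw [mul_assoc, mul_assoc]
    refine headsMeet_of ⟨1, ?_, ?_⟩
    · rw [compl_braid k, mul_one]; rfl
    · rw [compl_braid k.symm, mul_one]; rfl
  | r₄ j h i =>
    have k : (PGen.s j : PGen e r).level + 1 < (PGen.t i : PGen e r).level ∨
        (PGen.t i : PGen e r).level + 1 < (PGen.s j : PGen e r).level := by
      simp only [PGen.level]; omega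
    refine headsMeet_of ⟨1, ?_, ?_⟩
    · rw [compl_comm k, mul_one]; rfl
    · rw [compl_comm k.symm, mul_one]; rfl
  | r₅ i j =>
    refine headsMeet_of ?_
    by_cases hij : i = j
    · subst hij; rw [meets_self]
    · have hne : (PGen.t i : PGen e r) ≠ PGen.t j := fun h => hij (PGen.t.inj h)
      refine ⟨1, ?_, ?_⟩
      · rw [compl_level hne rfl, mul_one]; rfl
      · rw [compl_level hne.symm rfl, mul_one]; rfl

/-- Induction on the derivation of the congruence. Relations are homogeneous, so lengths agree
throughout. Transitivity is the cube condition at the first letter of the middle word, whose tail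
has length at most $n$. -/
theorem headsMeet_of_conGen {n : ℕ} (H : MeetsBelow e r n) {w w' : FreeMonoid (PGen e r)}
    (h : ConGen.Rel (PRel e r) w w') :
    PresentedMonoid.mk (PRel e r) w = PresentedMonoid.mk (PRel e r) w' ∧
      w.length = w'.length ∧ (w.length ≤ n + 1 → HeadsMeet w w') := by
  have hlen : ∀ {w w' : FreeMonoid (PGen e r)}, PresentedMonoid.mk (PRel e r) w =
      PresentedMonoid.mk (PRel e r) w' → w.length = w'.length := fun {w w'} h => by
    rw [← len_mk, ← len_mk, h]
  induction h with
  | of x y h =>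
    have h' := PresentedMonoid.mk_eq_mk_of_rel h
    exact ⟨h', hlen h', fun _ => headsMeet_of_rel h⟩
  | refl x =>
    refine ⟨rfl, rfl, fun _ a x b y h1 h2 => ?_⟩
    obtain ⟨rfl, rfl⟩ := List.cons.inj (h1.symm.trans h2)
    exact meets_self.2 rfl
  | symm _ ih =>
    exact ⟨ih.1.symm, ih.2.1.symm, fun hn a x b y h1 h2 =>
      (ih.2.2 (ih.2.1 ▸ hn) b y a x h2 h1).symm⟩
  | @trans x y z _ _ ih1 ih2 =>
    refine ⟨ih1.1.trans ih2.1, ih1.2.1.trans ih2.2.1, fun hn a x' b z' h1 h2 => ?_⟩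
    have hy : y.length ≠ 0 := by rw [← ih1.2.1, h1]; simp
    cases y using FreeMonoid.casesOn with
    | one => simp at hy
    | of_mul c y' =>
      refine H.cube ?_ (ih1.2.2 hn a x' c y' h1 rfl)
        (ih2.2.2 (ih1.2.1 ▸ hn) c y' b z' rfl h2)
      rw [len_mk]
      have := ih1.2.1
      simp at this
      omega
  | @mul x x' y y' _ _ ih1 ih2 =>
    refine ⟨by rw [map_mul, map_mul, ih1.1, ih2.1], by simp [ih1.2.1, ih2.2.1], fun hn => ?_⟩
    cases x using FreeMonoid.casesOn with
    | one =>
      have hx' : x' = 1 := by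
        rw [← FreeMonoid.length_eq_zero, ← ih1.2.1]; rfl
      subst hx'
      simpa using ih2.2.2 (by simpa using hn)
    | of_mul c z =>
      cases x' using FreeMonoid.casesOn with
      | one => have := ih1.2.1; simp at this
      | of_mul d z' =>
        rw [mul_assoc, mul_assoc]
        rw [FreeMonoid.length_mul] at hn
        obtain ⟨q, h1, h2⟩ := ih1.2.2 (by omega) c z d z' rfl rfl
        -- The heads lie in the left factors, so the common tail is only prolonged on the right.
        refine headsMeet_of ⟨q * PresentedMonoid.mk _ y, ?_, ?_⟩
        · rw [map_mul, h1, mul_assoc]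
        · rw [map_mul, h2, ih2.1, mul_assoc]

theorem meetsBelow (n : ℕ) : MeetsBelow e r n := by
  induction n with
  | zero => intro a b x y h; omega
  | succ n ih =>
    intro a b x y hn h
    induction x using PresentedMonoid.inductionOn with | _ x
    induction y using PresentedMonoid.inductionOn with | _ y
    have h' : PresentedMonoid.mk (PRel e r) (FreeMonoid.of a * x) =
        PresentedMonoid.mk (PRel e r) (FreeMonoid.of b * y) := h
    rw [PresentedMonoid.mk_eq_mk_iff] at h'
    rw [len_mk] at hn
    exact (headsMeet_of_conGen ih h').2.2 (by simp; omega) a x b y rfl rfl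

theorem PMonoid.mul_left_cancel {x y z : PMonoid e r} (h : x * y = x * z) : y = z := by
  induction x using PresentedMonoid.inductionOn with | _ w
  induction w generalizing y z with
  | one => simpa using h
  | of a => exact (meetsBelow _).cancel (Nat.lt_succ_self _) h
  | mul u v hu hv =>
    rw [map_mul, mul_assoc, mul_assoc] at h
    exact hv (hu h)

end Cube
end ParachuteBraid
namespace ParachuteBraid

/-! ### Ore's embedding theorem -/

section Ore

universe u

/-- Every element of a monoid generated by factors of a central element `z` has a left multiple
that is a power of `z`. -/
theorem exists_mul_eq_pow {M : Type*} [Monoid M] {z : M} (hz : ∀ x, z * x = x * z) {s : Set M}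
    (hs : Submonoid.closure s = ⊤) (hd : ∀ g ∈ s, ∃ h, h * g = z) (x : M) :
    ∃ (y : M) (n : ℕ), y * x = z ^ n := by
  have hx : x ∈ Submonoid.closure s := hs ▸ Submonoid.mem_top x
  induction hx using Submonoid.closure_induction with
  | mem g hg =>
    obtain ⟨h, hh⟩ := hd g hg
    exact ⟨h, 1, by rw [hh, pow_one]⟩
  | one => exact ⟨1, 0, by simp⟩
  | mul x y _ _ hx hy =>
    obtain ⟨x', n, hx'⟩ := hx
    obtain ⟨y', m, hy'⟩ := hy
    refine ⟨y' * x', m + n, ?_⟩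
    have hc : Commute (z ^ n) y := Commute.pow_left (hz y) n
    rw [mul_assoc, ← mul_assoc x', hx', hc.eq, ← mul_assoc, hy', pow_add]

/-- A left cancellative monoid generated by factors of a central element embeds into a group. -/
theorem exists_injective_units {M : Type u} [Monoid M]
    (hcancel : ∀ x y y' : M, x * y = x * y' → y = y') {z : M} (hz : ∀ x, z * x = x * z)
    {s : Set M} (hs : Submonoid.closure s = ⊤) (hd : ∀ g ∈ s, ∃ h, h * g = z) :
    ∃ (N : Type u) (_ : Monoid N) (f : M →* Nˣ), Function.Injective f := by
  have hcen : ∀ (n : ℕ) (x : M), z ^ n * x = x * z ^ n := fun n x => Commute.pow_left (hz x) n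
  choose y n hy using exists_mul_eq_pow hz hs hd
  have hright : ∀ a b c : M, a * c = b * c → a = b := by
    intro a b c h
    -- A left cofactor of a central element is also a right cofactor, by left cancellation. Right
    -- cancellation follows.
    obtain ⟨d, hd⟩ : ∃ d, c * d = z ^ n c :=
      ⟨y c, hcancel (y c) _ _ (by rw [← mul_assoc, hy, hcen])⟩
    apply hcancel (z ^ n c)
    rw [hcen, hcen, ← hd, ← mul_assoc, ← mul_assoc, h]
  -- Every element is a denominator: the Ore condition holds because $z^{n}a=az^{n}=(ay_b)b$.
  let _ : OreLocalization.OreSet (⊤ : Submonoid M) :=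
    { ore_right_cancel := fun a b c h => ⟨1, by rw [hright a b c h]⟩
      oreNum := fun a b => a * y b
      oreDenom := fun a b => ⟨z ^ n (b : M), Submonoid.mem_top _⟩
      ore_eq := fun a b => by
        change z ^ n (b : M) * a = a * y b * b
        rw [mul_assoc, hy, hcen] }
  refine ⟨OreLocalization (⊤ : Submonoid M) M, inferInstance,
    Units.liftRight OreLocalization.numeratorHom
      (fun x => OreLocalization.numeratorUnit ⟨x, Submonoid.mem_top x⟩) (fun x => rfl), ?_⟩
  intro a b hab
  have h : a /ₒ (1 : (⊤ : Submonoid M)) = b /ₒ (1 : (⊤ : Submonoid M)) := congrArg Units.val hab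
  rw [OreLocalization.oreDiv_eq_iff] at h
  obtain ⟨u, v, h1, h2⟩ := h
  simp only [Submonoid.coe_one, mul_one] at h2
  rw [← h2] at h1
  exact (hcancel _ _ _ h1).symm

end Ore

/-! ### A central element -/

section Garside

variable {e : ℕ} {M : Type*} [Monoid M]

/-- The elements `q₀ = t₁ t₀`, `q_{n+1} = s_{n+3} q_n s_{n+3}`, for `σ n = s_{n+3}`. -/
def jucysMurphy (δ : M) (σ : ℕ → M) : ℕ → M
  | 0 => δ
  | n + 1 => σ n * jucysMurphy δ σ n * σ n

/-- The product `q₀ q₁ ⋯ q_n`. -/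
def garside (δ : M) (σ : ℕ → M) : ℕ → M
  | 0 => jucysMurphy δ σ 0
  | n + 1 => garside δ σ n * jucysMurphy δ σ (n + 1)

/-- Elements `τ i` (`i ∈ ℤ/e`) and `σ n = s_{n+3}` (`n < N`) satisfying the relations of
`B⊕(e,e,N+2)`. -/
structure IsParachute (δ : M) (τ : ZMod e → M) (σ : ℕ → M) (N : ℕ) : Prop where
  mul_shift : ∀ i, τ i * τ (i - 1) = δ
  braid_zero : 0 < N → ∀ i, τ i * (σ 0 * τ i) = σ 0 * (τ i * σ 0)
  comm : ∀ n < N, n ≠ 0 → ∀ i, Commute (σ n) (τ i)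
  braid : ∀ n, n + 1 < N → σ n * (σ (n + 1) * σ n) = σ (n + 1) * (σ n * σ (n + 1))
  far : ∀ m n, m + 1 < n → n < N → Commute (σ m) (σ n)

namespace IsParachute

variable {δ : M} {τ : ZMod e → M} {σ : ℕ → M} {N : ℕ}

theorem delta_comm (h : IsParachute δ τ σ N) {n : ℕ} (hn : n < N) (h0 : n ≠ 0) :
    Commute (σ n) δ := by
  rw [← h.mul_shift 0]
  exact (h.comm n hn h0 _).mul_right (h.comm n hn h0 _)

theorem mul_delta (h : IsParachute δ τ σ N) (i : ZMod e) : τ i * δ = δ * τ (i - 2) := by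
  calc τ i * δ = τ i * τ (i - 1) * τ (i - 1 - 1) := by rw [mul_assoc, h.mul_shift]
    _ = δ * τ (i - 2) := by rw [h.mul_shift, sub_sub, one_add_one_eq_two]

theorem commute_of_lt (h : IsParachute δ τ σ N) {m n : ℕ} (hnm : n < m) (hm : m < N) :
    Commute (σ m) (jucysMurphy δ σ n) := by
  induction n with
  | zero => exact h.delta_comm hm (by omega)
  | succ n ih =>
    have := (h.far n m (by omega) hm).symm
    exact (this.mul_right (ih (by omega))).mul_right this

/-- The critical case is $n=m+2$, where $q_n=\sigma_{m+1}\sigma_mq_m\sigma_m\sigma_{m+1}$: a braid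
move on the left turns $\sigma_m$ into $\sigma_{m+1}$, which passes $q_m$, and a braid move on the
right turns it back. -/
theorem commute_of_gt (h : IsParachute δ τ σ N) {m n : ℕ} (hmn : m + 1 < n) (hn : n ≤ N) :
    Commute (σ m) (jucysMurphy δ σ n) := by
  induction n with
  | zero => omega
  | succ n ih =>
    rcases Nat.lt_or_ge (m + 1) n with hlt | hge
    · have := h.far m n hlt (by omega)
      exact (this.mul_right (ih hlt (by omega))).mul_right this
    · obtain rfl : n = m + 1 := by omega
      have hb := h.braid m (by omega)
      have hc := (h.commute_of_lt (Nat.lt_succ_self m) (by omega)).eq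
      simp only [jucysMurphy, Commute, SemiconjBy, Nat.succ_eq_add_one, mul_assoc] at *
      calc σ m * (σ (m + 1) * (σ m * (jucysMurphy δ σ m * (σ m * σ (m + 1)))))
          = (σ m * (σ (m + 1) * σ m)) * (jucysMurphy δ σ m * (σ m * σ (m + 1))) := by
            simp only [mul_assoc]
        _ = σ (m + 1) * (σ m * ((σ (m + 1) * jucysMurphy δ σ m) * (σ m * σ (m + 1)))) := by
            rw [hb]; simp only [mul_assoc]
        _ = σ (m + 1) * (σ m * (jucysMurphy δ σ m * (σ (m + 1) * (σ m * σ (m + 1))))) := by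
            rw [hc]; simp only [mul_assoc]
        _ = _ := by rw [← hb]

/-- For $q_1=\sigma_0\delta\sigma_0$, write $\delta=\tau_i\tau_{i-1}$ with the given $i$ and apply
two braid moves. The later $\sigma_n$ commute with every $\tau_i$. -/
theorem mul_jucysMurphy (h : IsParachute δ τ σ N) {n : ℕ} (hn : n < N) (i : ZMod e) :
    τ i * jucysMurphy δ σ (n + 1) = jucysMurphy δ σ (n + 1) * τ (i - 1) := by
  induction n with
  | zero =>
    have hb := h.braid_zero hn
    simp only [jucysMurphy, mul_assoc]
    calc τ i * (σ 0 * (δ * σ 0)) = (τ i * (σ 0 * τ i)) * (τ (i - 1) * σ 0) := by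
          rw [← h.mul_shift i]; simp only [mul_assoc]
      _ = σ 0 * (τ i * (σ 0 * (τ (i - 1) * σ 0))) := by rw [hb]; simp only [mul_assoc]
      _ = σ 0 * (τ i * τ (i - 1) * (σ 0 * τ (i - 1))) := by rw [← hb]; simp only [mul_assoc]
      _ = _ := by rw [h.mul_shift]
  | succ n ih =>
    have hc := fun i => (h.comm (n + 1) hn (by omega) i).eq
    rw [jucysMurphy, ← mul_assoc, ← mul_assoc, ← hc, mul_assoc (σ (n + 1)) (τ i), ih (by omega),
      mul_assoc, mul_assoc _ (τ (i - 1)), ← hc]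
    simp only [mul_assoc]

theorem delta_commute (h : IsParachute δ τ σ N) {n : ℕ} (hn : n ≤ N) :
    Commute δ (jucysMurphy δ σ n) := by
  cases n with
  | zero => exact Commute.refl _
  | succ n =>
    have h1 := h.mul_jucysMurphy (n := n) (by omega)
    calc δ * jucysMurphy δ σ (n + 1) = τ 0 * (τ (0 - 1) * jucysMurphy δ σ (n + 1)) := by
          rw [← mul_assoc, h.mul_shift]
      _ = jucysMurphy δ σ (n + 1) * δ := by
          rw [h1, ← mul_assoc, h1, mul_assoc, h.mul_shift]

theorem commute_jucysMurphy (h : IsParachute δ τ σ N) {m n : ℕ} (hmn : m < n) (hn : n ≤ N) :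
    Commute (jucysMurphy δ σ m) (jucysMurphy δ σ n) := by
  induction m with
  | zero => exact h.delta_commute hn
  | succ m ih =>
    have := h.commute_of_gt (m := m) (by omega) hn
    exact (this.mul_left (ih (by omega))).mul_left this

/-- Since $\sigma_nq_n\sigma_n=q_{n+1}$, moving $\sigma_n$ across exchanges the two factors, and
these commute. -/
theorem commute_pair (h : IsParachute δ τ σ N) {n : ℕ} (hn : n < N) :
    Commute (σ n) (jucysMurphy δ σ n * jucysMurphy δ σ (n + 1)) := by
  have hc := (h.commute_jucysMurphy (Nat.lt_succ_self n) hn).eq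
  have h1 : σ n * (jucysMurphy δ σ n * jucysMurphy δ σ (n + 1)) =
      jucysMurphy δ σ (n + 1) * jucysMurphy δ σ n * σ n := by
    simp only [jucysMurphy, mul_assoc]
  rw [Commute, SemiconjBy, h1, ← hc]

theorem commute_garside_of_lt (h : IsParachute δ τ σ N) {m n : ℕ} (hnm : n < m) (hm : m < N) :
    Commute (σ m) (garside δ σ n) := by
  induction n with
  | zero => exact h.commute_of_lt hnm hm
  | succ n ih => exact (ih (by omega)).mul_right (h.commute_of_lt hnm hm)

theorem commute_garside (h : IsParachute δ τ σ N) {m n : ℕ} (hmn : m < n) (hn : n ≤ N) :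
    Commute (σ m) (garside δ σ n) := by
  induction n with
  | zero => omega
  | succ n ih =>
    rcases Nat.lt_or_ge m n with hlt | hge
    · exact (ih hlt (by omega)).mul_right (h.commute_of_gt (by omega) hn)
    · obtain rfl : m = n := by omega
      cases m with
      | zero => exact h.commute_pair hn
      | succ m =>
        rw [garside, garside, mul_assoc]
        exact (h.commute_garside_of_lt (by omega) hn).mul_right (h.commute_pair hn)

/-- The factor $q_0$ shifts the index by 2 and each later factor by 1. -/
theorem mul_garside (h : IsParachute δ τ σ N) {n : ℕ} (hn : n ≤ N) (i : ZMod e) :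
    τ i * garside δ σ n = garside δ σ n * τ (i - (n + 2 : ℕ)) := by
  induction n generalizing i with
  | zero => simpa [garside, jucysMurphy] using h.mul_delta i
  | succ n ih =>
    rw [garside, ← mul_assoc, ih (by omega), mul_assoc, h.mul_jucysMurphy (by omega), mul_assoc]
    congr 3
    push_cast; ring

/-- The power `garside ^ e` is central on the generators. -/
theorem mul_garside_pow (h : IsParachute δ τ σ N) (i : ZMod e) :
    Commute (τ i) (garside δ σ N ^ e) := by
  have key : ∀ (k : ℕ) (i : ZMod e), τ i * garside δ σ N ^ k =
      garside δ σ N ^ k * τ (i - (k * (N + 2) : ℕ)) := by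
    intro k
    induction k with
    | zero => simp
    | succ k ih =>
      intro i
      rw [pow_succ, ← mul_assoc, ih, mul_assoc, h.mul_garside le_rfl, mul_assoc]
      congr 3
      push_cast; ring
  -- The total shift $e(N+2)$ vanishes in $\mathbb{Z}/e$.
  have := key e i
  rwa [Nat.cast_mul, ZMod.natCast_self, zero_mul, sub_zero] at this

theorem exists_garside_eq (δ : M) (σ : ℕ → M) {m n : ℕ} (hmn : m ≤ n) :
    ∃ x y, garside δ σ n = x * jucysMurphy δ σ m * y := by
  induction n with
  | zero =>
    obtain rfl : m = 0 := by omega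
    exact ⟨1, 1, by simp [garside]⟩
  | succ n ih =>
    rcases Nat.lt_or_ge n m with hlt | hge
    · obtain rfl : m = n + 1 := by omega
      exact ⟨garside δ σ n, 1, by simp [garside]⟩
    · obtain ⟨x, y, hxy⟩ := ih hge
      exact ⟨x, y * jucysMurphy δ σ (n + 1), by rw [garside, hxy, mul_assoc _ y]⟩

end IsParachute

end Garside

/-! ### Circles in a group -/

section Circle

variable {G : Type*} [Group G]

theorem circle_mul (g₁ g₀ : G) (n : ℕ) :
    circle g₁ g₀ (n + 1) * circle g₁ g₀ n = g₁ * g₀ := by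
  induction n with
  | zero => rfl
  | succ n ih => rw [circle, inv_mul_cancel_right, ih]

theorem circle_mul_altProd (g₁ g₀ : G) (n : ℕ) :
    circle g₁ g₀ (n + 1) * altProd g₁ g₀ n = altProd g₁ g₀ (n + 1) := by
  induction n with
  | zero => rfl
  | succ n ih =>
    rw [← ih, ← mul_assoc, circle_mul, mul_assoc]
    rfl

/-- Both alternating products end in $\langle g_1g_0\rangle^{n-1}$, preceded by the $n$-th circle
element and by $g_0$ respectively. -/
theorem altProd_eq_iff (g₁ g₀ : G) {n : ℕ} (hn : 1 ≤ n) :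
    altProd g₁ g₀ n = altProd g₀ g₁ n ↔ circle g₁ g₀ n = g₀ := by
  obtain ⟨n, rfl⟩ : ∃ m, n = m + 1 := ⟨n - 1, by omega⟩
  rw [← circle_mul_altProd]
  change _ = g₀ * altProd g₁ g₀ n ↔ _
  exact mul_left_inj _

/-- The circle is determined by its first element and the product of consecutive elements. -/
theorem circle_eq {g₁ g₀ : G} {c : ℕ → G} (h0 : c 0 = g₀)
    (hc : ∀ n, c (n + 1) * c n = g₁ * g₀) (n : ℕ) : circle g₁ g₀ n = c n := by
  induction n with
  | zero => exact h0.symm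
  | succ n ih =>
    have h1 := circle_mul g₁ g₀ n
    rw [← hc n, ih] at h1
    exact mul_right_cancel h1

theorem map_circle {G' : Type*} [Group G'] (f : G →* G') (g₁ g₀ : G) (n : ℕ) :
    f (circle g₁ g₀ n) = circle (f g₁) (f g₀) n :=
  (circle_eq (g₁ := f g₁) (g₀ := f g₀) (c := fun n => f (circle g₁ g₀ n)) rfl
    (fun n => by rw [← map_mul, ← map_mul, circle_mul]) n).symm

theorem map_altProd {M M' : Type*} [Monoid M] [Monoid M'] (f : M →* M') (a b : M) (n : ℕ) :
    f (altProd a b n) = altProd (f a) (f b) n := by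
  induction n generalizing a b with
  | zero => exact map_one f
  | succ n ih => rw [altProd, altProd, map_mul, ih]

theorem circle_commute {g₁ g₀ s : G} (h₁ : Commute s g₁) (h₀ : Commute s g₀) (n : ℕ) :
    Commute s (circle g₁ g₀ n) := by
  induction n using circle.induct with
  | case1 => exact h₀
  | case2 => exact h₁
  | case3 n ih1 ih2 => exact (ih1.mul_right ih2).mul_right ih1.inv_right

/-- After right multiplication by $g_1sg_0$ the two sides become the two sides of the triangle
relation. -/
theorem braid_succ {s g₂ g₁ g₀ : G} (h₂ : g₂ * g₁ = g₁ * g₀)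
    (h₁ : s * g₁ * s = g₁ * s * g₁) (h₀ : s * g₀ * s = g₀ * s * g₀)
    (h : (s * g₁ * g₀) ^ 2 = (g₁ * g₀ * s) ^ 2) : s * g₂ * s = g₂ * s * g₂ := by
  rw [sq, sq] at h
  apply mul_right_cancel (b := g₁ * s * g₀)
  calc s * g₂ * s * (g₁ * s * g₀) = s * g₂ * (s * g₁ * s) * g₀ := by simp only [mul_assoc]
    _ = s * (g₂ * g₁) * s * g₁ * g₀ := by rw [h₁]; simp only [mul_assoc]
    _ = s * g₁ * g₀ * (s * g₁ * g₀) := by rw [h₂]; simp only [mul_assoc]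
    _ = (g₁ * g₀) * s * (g₁ * g₀ * s) := h
    _ = g₂ * (g₁ * s * g₁) * g₀ * s := by
      rw [mul_assoc (g₁ * g₀) s]; nth_rewrite 1 [← h₂]; simp only [mul_assoc]
    _ = g₂ * s * g₁ * (s * g₀ * s) := by rw [← h₁]; simp only [mul_assoc]
    _ = g₂ * s * (g₁ * g₀) * s * g₀ := by rw [h₀]; simp only [mul_assoc]
    _ = g₂ * s * g₂ * (g₁ * s * g₀) := by rw [← h₂]; simp only [mul_assoc]

theorem circle_braid {g₁ g₀ s : G} (h₁ : s * g₁ * s = g₁ * s * g₁)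
    (h₀ : s * g₀ * s = g₀ * s * g₀) (h : (s * g₁ * g₀) ^ 2 = (g₁ * g₀ * s) ^ 2) (n : ℕ) :
    s * circle g₁ g₀ n * s = circle g₁ g₀ n * s * circle g₁ g₀ n := by
  induction n using circle.induct with
  | case1 => exact h₀
  | case2 => exact h₁
  | case3 n ih1 ih2 =>
    refine braid_succ (g₁ := circle g₁ g₀ (n + 1)) (g₀ := circle g₁ g₀ n) ?_ ih1 ih2 ?_
    · rw [circle_mul, circle_mul]
    -- The triangle relation involves $g_1,g_0$ only through their product, which is constant along
    -- the circle.
    · rwa [mul_assoc, circle_mul, ← mul_assoc]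

end Circle

end ParachuteBraid
namespace ParachuteBraid

/-! ### Embedding of `B⊕(e,e,r)` in `B(e,e,r)` -/

section Embedding

/-- The element `s_{n+3}` of `B⊕(e,e,r)`, and `1` if there is no such generator. -/
def PMonoid.sNat (e r n : ℕ) : PMonoid e r :=
  if h : n + 3 ≤ r then PMonoid.s e ⟨n + 3, by omega, h⟩ else 1

theorem PMonoid.sNat_of_lt {e r n : ℕ} (h : n < r - 2) :
    PMonoid.sNat e r n = gen (PGen.s ⟨n + 3, by omega, by omega⟩) :=
  dif_pos (by omega)

theorem isParachute (e r : ℕ) :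
    IsParachute (PMonoid.t r (1 : ZMod e) * PMonoid.t r 0) (PMonoid.t r) (PMonoid.sNat e r)
      (r - 2) where
  mul_shift i := by
    have h : (PGen.t i : PGen e r).level = (PGen.t 1 : PGen e r).level := rfl
    have h' := gen_mul_shift h
    simp only [PGen.shift, sub_self] at h'
    exact h'
  braid_zero h i := by
    rw [PMonoid.sNat_of_lt h]
    exact gen_braid (a := PGen.t i) (by simp [PGen.level])
  comm n hn h0 i := by
    rw [PMonoid.sNat_of_lt hn]
    exact gen_comm (b := PGen.t i) (by simp only [PGen.level]; omega)
  braid n hn := by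
    rw [PMonoid.sNat_of_lt hn, PMonoid.sNat_of_lt (by omega)]
    exact gen_braid (by simp [PGen.level])
  far m n hmn hn := by
    rw [PMonoid.sNat_of_lt hn, PMonoid.sNat_of_lt (by omega)]
    exact gen_comm (by simp only [PGen.level]; omega)

/-- `B⊕(e,e,r)` embeds into a group. -/
theorem PMonoid.exists_injective_units (e r : ℕ) (he : 1 ≤ e) (hr : 2 ≤ r) :
    ∃ (N : Type) (_ : Monoid N) (f : PMonoid e r →* Nˣ), Function.Injective f := by
  have P := isParachute e r
  set δ := PMonoid.t r (1 : ZMod e) * PMonoid.t r 0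
  set g := garside δ (PMonoid.sNat e r) (r - 2) with hg
  have hs : ∀ j : SIdx r, PMonoid.s e j = PMonoid.sNat e r (j.1 - 3) := by
    rintro ⟨j, h3, hj⟩
    obtain ⟨n, rfl⟩ := Nat.exists_eq_add_of_le' h3
    rw [show n + 3 - 3 = n from rfl, PMonoid.sNat, dif_pos hj]
  have hcen : ∀ x, g ^ e * x = x * g ^ e := by
    intro x
    have hx : x ∈ Submonoid.closure (Set.range (PresentedMonoid.of (PRel e r))) := by simp
    induction hx using Submonoid.closure_induction with
    | mem x hx =>
      obtain ⟨i | j, rfl⟩ := hx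
      · exact (P.mul_garside_pow i).eq.symm
      · change g ^ e * PMonoid.s e j = PMonoid.s e j * g ^ e
        rw [hs]
        have := j.2
        exact ((P.commute_garside (by omega) le_rfl).pow_right e).eq.symm
    | one => simp
    | mul x y _ _ hx hy => rw [← mul_assoc, hx, mul_assoc, hy, mul_assoc]
  refine ParachuteBraid.exists_injective_units
    (fun x y y' => PMonoid.mul_left_cancel) hcen (PresentedMonoid.closure_range_of _) ?_
  -- From $g=xay$ and $e\ge1$, $g^e=x\,a\,(yg^{e-1})$. As $g^e$ is central, left cancellation
  -- permutes these factors cyclically until $a$ comes last.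
  have hfac : ∀ a : PMonoid e r, (∃ x y, g = x * a * y) → ∃ h, h * a = g ^ e := by
    rintro a ⟨x, y, hxy⟩
    have hge : g ^ e = x * (a * (y * g ^ (e - 1))) := by
      rw [← mul_pow_sub_one (by omega : e ≠ 0), ← mul_assoc a, ← mul_assoc x, ← mul_assoc x, ← hxy]
    have h1 : a * (y * g ^ (e - 1) * x) = g ^ e := by
      apply PMonoid.mul_left_cancel (x := x)
      rw [← hcen, hge]
      simp only [mul_assoc]
    refine ⟨y * g ^ (e - 1) * x, PMonoid.mul_left_cancel (x := a) ?_⟩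
    rw [← mul_assoc, h1, hcen]
  rintro _ ⟨i | j, rfl⟩
  · apply hfac
    obtain ⟨x, y, hxy⟩ := IsParachute.exists_garside_eq δ (PMonoid.sNat e r) (Nat.zero_le (r - 2))
    refine ⟨x, PMonoid.t r (i - 1) * y, ?_⟩
    rw [hg, hxy, jucysMurphy, ← P.mul_shift i]
    simp only [mul_assoc]
    rfl
  · apply hfac
    have hj := j.2
    obtain ⟨x, y, hxy⟩ := IsParachute.exists_garside_eq δ (PMonoid.sNat e r)
      (show j.1 - 3 + 1 ≤ r - 2 by omega)
    refine ⟨x, jucysMurphy δ (PMonoid.sNat e r) (j.1 - 3) * PMonoid.sNat e r (j.1 - 3) * y, ?_⟩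
    change g = x * PMonoid.s e j * _
    rw [hg, hxy, jucysMurphy, hs]
    simp only [mul_assoc]

/-! ### The canonical homomorphism and its universal property. -/

/-- The defining relations of `B(e,e,r)` hold in it. -/
theorem BraidGroup.mk_eq {e r : ℕ} {u v : FreeGroup (BraidGen r)} (h : BraidRel e r u v) :
    (PresentedGroup.mk _ u : BraidGroup e r) = PresentedGroup.mk _ v := by
  rw [← mul_inv_eq_one, ← map_inv, ← map_mul, PresentedGroup.one_of_mem]
  exact ⟨u, v, h, rfl⟩

theorem BraidGroup.circle_self (e r : ℕ) (he : 1 ≤ e) :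
    circle (PresentedGroup.of BraidGen.t₁ : BraidGroup e r) (PresentedGroup.of BraidGen.t₀) e =
      PresentedGroup.of BraidGen.t₀ := by
  rw [← altProd_eq_iff _ _ he]
  have := BraidGroup.mk_eq (BraidRel.alt (e := e) (r := r))
  rw [map_altProd, map_altProd] at this
  exact this

theorem BraidGroup.t_mul_t {e : ℕ} (r : ℕ) (he : 1 ≤ e) (i : ZMod e) :
    BraidGroup.t r i * BraidGroup.t r (i - 1) =
      PresentedGroup.of BraidGen.t₁ * PresentedGroup.of BraidGen.t₀ := by
  have : NeZero e := ⟨by omega⟩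
  obtain ⟨k, rfl⟩ : ∃ k, i = k + 1 := ⟨i - 1, by ring⟩
  rw [add_sub_cancel_right]
  obtain ⟨m, hm, rfl⟩ : ∃ m : ℕ, m < e ∧ (m : ZMod e) = k :=
    ⟨k.val, ZMod.val_lt k, ZMod.natCast_zmod_val k⟩
  unfold BraidGroup.t
  rw [ZMod.val_natCast_of_lt hm, ← Nat.cast_succ]
  rcases Nat.lt_or_ge (m + 1) e with h | h
  · rw [ZMod.val_natCast_of_lt h, circle_mul]
  -- The wrap-around product $t_0t_{e-1}$, where the circle must close up.
  · obtain rfl : m + 1 = e := by omega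
    have h1 := circle_mul (PresentedGroup.of BraidGen.t₁ : BraidGroup (m + 1) r)
      (PresentedGroup.of BraidGen.t₀) m
    rw [BraidGroup.circle_self _ _ he] at h1
    rw [ZMod.natCast_self, ZMod.val_zero]
    exact h1

/-- The canonical homomorphism from `B⊕(e,e,r)` to `B(e,e,r)`. -/
def PMonoid.toBraidGroup (e r : ℕ) (he : 1 ≤ e) : PMonoid e r →* BraidGroup e r :=
  PresentedMonoid.lift
    (fun a => match a with
      | .t i => BraidGroup.t r i
      | .s j => BraidGroup.s e j) (by
    intro a b h
    cases h with
    | r₁ i j h => exact BraidGroup.mk_eq (BraidRel.braid i j h)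
    | r₂ i j h => exact BraidGroup.mk_eq (BraidRel.comm i j h)
    | r₃ j h i =>
      exact circle_braid (BraidGroup.mk_eq (BraidRel.braid₁ j h))
        (BraidGroup.mk_eq (BraidRel.braid₀ j h)) (BraidGroup.mk_eq (BraidRel.triangle j h)) _
    | r₄ j h i =>
      have h₁ : Commute (BraidGroup.s e j) (PresentedGroup.of BraidGen.t₁) :=
        BraidGroup.mk_eq (BraidRel.comm₁ j h)
      have h₀ : Commute (BraidGroup.s e j) (PresentedGroup.of BraidGen.t₀) :=
        BraidGroup.mk_eq (BraidRel.comm₀ j h)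
      exact (circle_commute h₁ h₀ _).eq
    | r₅ i j =>
      exact (BraidGroup.t_mul_t r he i).trans (BraidGroup.t_mul_t r he j).symm)

/-- Every homomorphism from `B⊕(e,e,r)` to a group factors through `B(e,e,r)`. -/
theorem PMonoid.exists_factor (e r : ℕ) (he : 1 ≤ e) {G : Type*} [Group G]
    (f : PMonoid e r →* G) :
    ∃ F : BraidGroup e r →* G, F.comp (PMonoid.toBraidGroup e r he) = f := by
  have : NeZero e := ⟨by omega⟩
  have P := isParachute e r
  have hcirc : ∀ n : ℕ, circle (f (PMonoid.t r (1 : ZMod e))) (f (PMonoid.t r (0 : ZMod e))) n =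
      f (PMonoid.t r (n : ZMod e)) := by
    intro n
    refine circle_eq (c := fun n : ℕ => f (PMonoid.t r (n : ZMod e))) (by simp) (fun n => ?_) n
    rw [← map_mul, ← map_mul, ← P.mul_shift ((n + 1 : ℕ) : ZMod e)]
    simp
  have hmk : ∀ {u v : FreeMonoid (PGen e r)}, PRel e r u v →
      f (PresentedMonoid.mk _ u) = f (PresentedMonoid.mk _ v) := fun h => by
    rw [PresentedMonoid.mk_eq_mk_of_rel h]
  let φ : BraidGen r → G := fun a => match a with
    | .t₀ => f (PMonoid.t r (0 : ZMod e))
    | .t₁ => f (PMonoid.t r (1 : ZMod e))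
    | .s j => f (PMonoid.s e j)
  have hφ : ∀ u v, BraidRel e r u v → FreeGroup.lift φ u = FreeGroup.lift φ v := by
    intro u v h
    cases h with
    | braid i j h =>
      have := hmk (PRel.r₁ i j h)
      simp only [map_mul] at this
      simp only [fs, map_mul, FreeGroup.lift_apply_of]
      exact this
    | comm i j h =>
      have := hmk (PRel.r₂ i j h)
      simp only [map_mul] at this
      simp only [fs, map_mul, FreeGroup.lift_apply_of]
      exact this
    | alt =>
      rw [map_altProd, map_altProd, ft₁, ft₀, FreeGroup.lift_apply_of, FreeGroup.lift_apply_of,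
        altProd_eq_iff _ _ he]
      exact (hcirc e).trans (by simp [φ])
    | braid₀ j h =>
      have := hmk (PRel.r₃ j h 0)
      simp only [map_mul] at this
      simp only [fs, ft₀, map_mul, FreeGroup.lift_apply_of]
      exact this
    | braid₁ j h =>
      have := hmk (PRel.r₃ j h 1)
      simp only [map_mul] at this
      simp only [fs, ft₁, map_mul, FreeGroup.lift_apply_of]
      exact this
    | comm₀ j h =>
      have := hmk (PRel.r₄ j h 0)
      simp only [map_mul] at this
      simp only [fs, ft₀, map_mul, FreeGroup.lift_apply_of]
      exact this
    | comm₁ j h =>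
      have := hmk (PRel.r₄ j h 1)
      simp only [map_mul] at this
      simp only [fs, ft₁, map_mul, FreeGroup.lift_apply_of]
      exact this
    | triangle j h =>
      have hr := j.2
      -- With $\delta=t_1t_0$, the triangle relation reads $(s_3\delta s_3)\delta=\delta(s_3\delta
      -- s_3)$: $q_1$ commutes with $q_0$.
      have hc := (P.delta_commute (n := 1) (by omega)).eq
      have hs : PMonoid.sNat e r 0 = PMonoid.s e j := by
        rw [PMonoid.sNat, dif_pos (by omega)]
        congr 1
        exact Subtype.ext h.symm
      simp only [jucysMurphy, hs] at hc
      have := congrArg f hc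
      simp only [map_mul] at this
      simp only [fs, ft₁, ft₀, map_mul, FreeGroup.lift_apply_of, sq]
      simpa only [mul_assoc] using this.symm
  have hrel : ∀ w ∈ {w | ∃ u v, BraidRel e r u v ∧ w = u * v⁻¹}, FreeGroup.lift φ w = 1 := by
    rintro _ ⟨u, v, h, rfl⟩
    rw [map_mul, map_inv, hφ u v h, mul_inv_cancel]
  refine ⟨PresentedGroup.toGroup hrel, PresentedMonoid.ext _ ?_⟩
  rintro (i | j)
  · change PresentedGroup.toGroup hrel (circle _ _ i.val) = f (PMonoid.t r i)
    rw [map_circle, PresentedGroup.toGroup.of, PresentedGroup.toGroup.of]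
    exact (hcirc i.val).trans (by rw [ZMod.natCast_zmod_val])
  · change PresentedGroup.toGroup hrel (PresentedGroup.of _) = _
    rw [PresentedGroup.toGroup.of]
    rfl

theorem PMonoid.toBraidGroup_injective (e r : ℕ) (he : 1 ≤ e) (hr : 2 ≤ r) :
    Function.Injective (PMonoid.toBraidGroup e r he) := by
  obtain ⟨N, _, f, hf⟩ := PMonoid.exists_injective_units e r he hr
  obtain ⟨F, hF⟩ := PMonoid.exists_factor e r he f
  rw [← hF] at hf
  exact Function.Injective.of_comp hf

theorem PMonoid.mrange_toBraidGroup (e r : ℕ) (he : 1 ≤ e) :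
    MonoidHom.mrange (PMonoid.toBraidGroup e r he) = positiveSubmonoid e r := by
  rw [MonoidHom.mrange_eq_map, ← PresentedMonoid.closure_range_of, MonoidHom.map_mclosure,
    positiveSubmonoid]
  congr 1
  ext x
  constructor
  · rintro ⟨_, ⟨i | j, rfl⟩, rfl⟩
    · exact Or.inl ⟨i, rfl⟩
    · exact Or.inr ⟨j, rfl⟩
  · rintro (⟨i, rfl⟩ | ⟨j, rfl⟩)
    · exact ⟨_, ⟨PGen.t i, rfl⟩, rfl⟩
    · exact ⟨_, ⟨PGen.s j, rfl⟩, rfl⟩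

end Embedding
end ParachuteBraid

/-- The submonoid of `B(e,e,r)` generated by `T_e ∪ S_r` is presented, on these generators, by
`P⊕(e,e,r)`: it is isomorphic to `B⊕(e,e,r)` by an isomorphism that matches the generators. -/
theorem proposition2p2 (e r : ℕ) (he : 1 ≤ e) (hr : 2 ≤ r) :
    ∃ φ : ParachuteBraid.PMonoid e r ≃* ParachuteBraid.positiveSubmonoid e r,
      (∀ i : ZMod e,
        (φ (ParachuteBraid.PMonoid.t r i) : ParachuteBraid.BraidGroup e r) =
          ParachuteBraid.BraidGroup.t r i) ∧
      (∀ j : ParachuteBraid.SIdx r,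
        (φ (ParachuteBraid.PMonoid.s e j) : ParachuteBraid.BraidGroup e r) =
          ParachuteBraid.BraidGroup.s e j) := by
  have hmem : ∀ x, ParachuteBraid.PMonoid.toBraidGroup e r he x ∈
      ParachuteBraid.positiveSubmonoid e r := fun x => by
    rw [← ParachuteBraid.PMonoid.mrange_toBraidGroup e r he]
    exact ⟨x, rfl⟩
  refine ⟨MulEquiv.ofBijective
    ((ParachuteBraid.PMonoid.toBraidGroup e r he).codRestrict _ hmem) ⟨?_, ?_⟩,
    fun i => rfl, fun j => rfl⟩
  · intro x y hxy
    exact ParachuteBraid.PMonoid.toBraidGroup_injective e r he hr (congrArg Subtype.val hxy)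
  · rintro ⟨y, hy⟩
    rw [← ParachuteBraid.PMonoid.mrange_toBraidGroup e r he] at hy
    obtain ⟨x, hx⟩ := hy
    exact ⟨x, Subtype.ext hx⟩
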